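/- Let $\mathrm{QConv}$ be the symmetric operad with $\mathrm{QConv}(n)=\{\vec\alpha\in(\mathbb R_{\ge0})^n : \sum_i\alpha_i=1\}$ and composition $\vec\alpha\circ(\vec\beta^1,\dots,\vec\beta^n)=(\alpha_i\beta^i_k)_{i,k}$. A $\mathrm{QConv}$-monoidal category is a category $\mathcal C$ with a functor $\otimes_{\vec\alpha}:\mathcal C^{n}\to\mathcal C$ for every $\vec\alpha\in\mathrm{QConv}(n)$, together with coherent natural isomorphisms for permutations, operadic composition and the operadic unit. A $\mathrm{QConv}$-monoidal functor is a functor $F$ with natural isomorphisms $\xi_{\vec\alpha}:\otimes_{\vec\alpha}\circ F^{n}\Rightarrow F\circ\otimes_{\vec\alpha}$ compatible with these structure isomorphisms. Let $\mathsf{FinProb}$ be the category of pairs $(X,p)$ of a finite set $X$ and a probability distribution $p$ on $X$, with measure-preserving functions as morphisms. It is the convex Grothendieck construction of the lax $\mathrm{QConv}$-monoidal functor $\mathsf{Dist}:(\mathsf{Fin},\amalg)\to(\mathsf{CSet},\otimes)$ from finite sets to convex sets, where $\mathsf{Dist}(X)$ is the convex set of probability distributions on $X$ and $\xi_{\vec\alpha}(p_1,\dots,p_n)=\sum_i\alpha_i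 p_i$ on $X_1\amalg\dots\amalg X_n$. As such it is $\mathrm{QConv}$-monoidal via $\otimes_{\vec\alpha}\big((X_i,p_i)\big)_i=\big(\coprod_i X_i,\sum_i\alpha_ip_i\big)$, and for each function $f:X\to Y$ of finite sets the set of morphisms of $\mathsf{FinProb}$ lying over $f$ carries the subspace topology from $\mathsf{Dist}(X)\times\mathsf{Dist}(Y)$, where $\mathsf{Dist}(X)\subseteq\mathbb R^X$. Let $B\mathbb R_{\ge0}$ be the one-object category with morphisms the monoid $(\mathbb R_{\ge0},+)$, with its usual topology and with the $\mathrm{QConv}$-monoidal structure $\otimes_{\vec\alpha}(r_1,\dots,r_n)=\sum_i\alpha_ir_i$. A functor $F:\mathsf{FinProb}\to B\mathbb R_{\ge0}$ is continuous if for every function $f$ of finite sets its restriction to the morphisms lying over $f$ is continuous. **Theorem.** For every continuous $\mathrm{QConv}$-monoidal functor $F:\mathsf{FinProb}\to B\mathbb R_{\ge0}$ there is a constant $c\ge0$ such that $$F(f)=c\,\big(H(X,p)-H(Y,q)\big)$$ for all morphisms $f:(X,p)\to(Y,q)$ of $\mathsf{FinProb}$, where $H(X,p)=-\sum_{x\in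 X}p(x)\ln p(x)$ is the Shannon entropy (with $0\ln0=0$). -/

import Mathlib

open CategoryTheory Convexity
open scoped NNReal

universe w v u v₁ u₁ v₂ u₂ v₃ u₃ v₄ u₄

noncomputable section

/-! ### Symmetric operads -/

/-- The canonical bijection `{*} × K ≃ K`. -/
def unitSigma (K : Type) : (Σ _ : Unit, K) ≃ K where
  toFun p := p.2
  invFun k := ⟨(), k⟩
  left_inv _ := rfl
  right_inv _ := rfl

/-- The canonical bijection `I × {*} ≃ I`. -/
def sigmaUnit (I : Type) : (Σ _ : I, Unit) ≃ I where
  toFun p := p.1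
  invFun i := ⟨i, ()⟩
  left_inv _ := rfl
  right_inv _ := rfl

/-- A (monochromatic) symmetric operad in sets, in coordinate-free form: the inputs of an operation
are labelled by an arbitrary finite set `I` (the `n`-ary operations are `Op (Fin n)`), the
symmetric groups act through `relabel`, and the inputs of a composite are labelled by the disjoint
union of the label sets of the inner operations. -/
structure SymmOperad where
  Op (I : Type) [Finite I] : Type
  relabel {I J : Type} [Finite I] [Finite J] (e : I ≃ J) : Op I → Op J
  one : Op Unit
  comp {I : Type} [Finite I] {K : I → Type} [∀ i, Finite (K i)] (z : Op I) (x : ∀ i, Op (K i)) :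
    Op (Σ i, K i)
  relabel_refl {I : Type} [Finite I] (z : Op I) : relabel (Equiv.refl I) z = z
  relabel_trans {I J L : Type} [Finite I] [Finite J] [Finite L] (e : I ≃ J) (e' : J ≃ L)
    (z : Op I) : relabel (e.trans e') z = relabel e' (relabel e z)
  comp_relabel_left {I J : Type} [Finite I] [Finite J] {K : J → Type} [∀ j, Finite (K j)]
    (e : I ≃ J) (z : Op I) (x : ∀ j, Op (K j)) :
    relabel (Equiv.sigmaCongrLeft e) (comp z (fun i => x (e i))) = comp (relabel e z) x
  comp_relabel_right {I : Type} [Finite I] {K L : I → Type} [∀ i, Finite (K i)]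
    [∀ i, Finite (L i)] (e : ∀ i, K i ≃ L i) (z : Op I) (x : ∀ i, Op (K i)) :
    relabel (Equiv.sigmaCongrRight e) (comp z x) = comp z (fun i => relabel (e i) (x i))
  one_comp {K : Type} [Finite K] (x : Op K) :
    relabel (unitSigma K) (comp one (fun _ => x)) = x
  comp_one {I : Type} [Finite I] (z : Op I) :
    relabel (sigmaUnit I) (comp z (fun _ => one)) = z
  assoc {I : Type} [Finite I] {K : I → Type} [∀ i, Finite (K i)] {L : ∀ i, K i → Type}
    [∀ i k, Finite (L i k)] (z : Op I) (x : ∀ i, Op (K i)) (y : ∀ i k, Op (L i k)) :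
    relabel (Equiv.sigmaAssoc L) (comp (comp z x) (fun p => y p.1 p.2)) =
      comp z (fun i => comp (x i) (y i))

section Mixture

variable {I : Type} {X : I → Type u}

/-- The mixture `∑ αᵢ pᵢ` of distributions `pᵢ` on sets `Xᵢ`, a distribution on the disjoint union
of the `Xᵢ`: here `pᵢ` is viewed as a distribution concentrated on the summand `Xᵢ`. -/
def mixture (α : StdSimplex ℝ≥0 I) (p : ∀ i, StdSimplex ℝ≥0 (X i)) : StdSimplex ℝ≥0 (Σ i, X i) :=
  α.iConvexComb fun i => (p i).map (Sigma.mk i)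

theorem mixture_map {Y : I → Type v} (α : StdSimplex ℝ≥0 I) (p : ∀ i, StdSimplex ℝ≥0 (X i))
    (f : ∀ i, X i → Y i) :
    mixture α (fun i => (p i).map (f i)) = (mixture α p).map fun q => ⟨q.1, f q.1 q.2⟩ := by
  unfold mixture
  rw [map_iConvexComb]
  congr 1; funext i
  simp only [Function.comp, StdSimplex.map_map]

theorem mixture_relabel {J : Type} {X : J → Type u} (e : I ≃ J) (α : StdSimplex ℝ≥0 I)
    (p : ∀ j, StdSimplex ℝ≥0 (X j)) :
    mixture (α.map e) p = (mixture α fun i => p (e i)).map (Equiv.sigmaCongrLeft e) := by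
  unfold mixture
  rw [map_iConvexComb, iConvexComb_map]
  congr 1; funext i
  simp only [Function.comp, StdSimplex.map_map]; rfl

theorem mixture_mixture {K : I → Type} {X : (Σ i, K i) → Type u} (α : StdSimplex ℝ≥0 I)
    (β : ∀ i, StdSimplex ℝ≥0 (K i)) (p : ∀ i k, StdSimplex ℝ≥0 (X ⟨i, k⟩)) :
    mixture (mixture α β) (fun q => p q.1 q.2) =
      (mixture α fun i => mixture (X := fun k => X ⟨i, k⟩) (β i) (p i)).map
        fun r => ⟨⟨r.1, r.2.1⟩, r.2.2⟩ := by
  unfold mixture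
  rw [map_iConvexComb]
  refine (iConvexComb_assoc'' α β fun i k =>
    (p i k).map (Sigma.mk (β := X) ⟨i, k⟩)).symm.trans ?_
  congr 1; funext i
  simp only [Function.comp]
  rw [map_iConvexComb, map_iConvexComb]
  congr 1; funext k
  simp only [Function.comp, StdSimplex.map_map]

theorem mixture_assoc {K : I → Type} {L : ∀ i, K i → Type} (α : StdSimplex ℝ≥0 I)
    (β : ∀ i, StdSimplex ℝ≥0 (K i)) (γ : ∀ i k, StdSimplex ℝ≥0 (L i k)) :
    (mixture (mixture α β) fun q => γ q.1 q.2).map (Equiv.sigmaAssoc L) =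
      mixture α fun i => mixture (β i) (γ i) := by
  rw [mixture_mixture (X := fun q => L q.1 q.2), StdSimplex.map_map]
  exact StdSimplex.map_id _

theorem mixture_single {X : Unit → Type u} (p : ∀ t, StdSimplex ℝ≥0 (X t))
    (f : (Σ t, X t) → X ()) (hf : ∀ x, f ⟨(), x⟩ = x) :
    (mixture (StdSimplex.single ()) p).map f = p () := by
  unfold mixture
  rw [iConvexComb_single, StdSimplex.map_map]
  simp only [hf]
  exact StdSimplex.map_id _

theorem mixture_const_single (α : StdSimplex ℝ≥0 I) :
    (mixture α fun _ => StdSimplex.single ()).map (sigmaUnit I) = α := by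
  unfold mixture
  rw [map_iConvexComb]
  ext1
  simp [iConvexComb, Finsupp.sum_mapDomain_index, add_smul, Function.comp_def, sigmaUnit]

/-- Mixtures are convex in each of the distributions `pᵢ`. -/
theorem mixture_update [DecidableEq I] (α : StdSimplex ℝ≥0 I) (p : ∀ i, StdSimplex ℝ≥0 (X i))
    (i : I) : IsAffineMap ℝ≥0 fun q => mixture α (Function.update p i q) := by
  constructor
  intro t
  refine Eq.trans ?_ (iConvexComb_comm t α fun q j =>
    (Function.update p i q j).map (Sigma.mk j)).symm
  refine congrArg (StdSimplex.iConvexComb α) (funext fun j => ?_)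
  by_cases h : j = i
  · subst h
    simp only [Function.update_self]
    exact StdSimplex.map_sConvexComb t _
  · simp [h]

end Mixture

/-- The operad for quasiconvexity: its `n`-ary operations are the vectors
`(α₁, …, αₙ)` of non-negative reals with `∑ αᵢ = 1`, and the composite of `α` with `β¹, …, βⁿ`
is the vector `(αᵢ βⁱₖ)`. -/
def QConv : SymmOperad where
  Op I _ := StdSimplex ℝ≥0 I
  relabel e α := α.map e
  one := StdSimplex.single ()
  comp α β := mixture α β
  relabel_refl α := α.map_id
  relabel_trans e e' α := α.map_comp e e'
  comp_relabel_left e α β := (mixture_relabel e α β).symm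
  comp_relabel_right e α β := (mixture_map α β fun i => e i).symm
  one_comp {K _} β := mixture_single (fun _ => β) (unitSigma K) fun _ => rfl
  comp_one α := mixture_const_single α
  assoc α β γ := mixture_assoc α β γ

/-! ### `O`-monoidal categories and functors -/

/-- An `O`-monoidal category: every operation `z` of the operad gives a functor `⊗_z` from families
of objects of `C` to `C`, with natural isomorphisms for the relabelling of the inputs, for the
operadic composition and for the operadic unit, subject to the usual coherence equations. -/
class OMonoidal (O : SymmOperad) (C : Type u) [Category.{v} C] where
  tensorObj {I : Type} [Finite I] (z : O.Op I) (X : I → C) : C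
  tensorMap {I : Type} [Finite I] (z : O.Op I) {X Y : I → C} (f : ∀ i, X i ⟶ Y i) :
    tensorObj z X ⟶ tensorObj z Y
  tensorMap_id {I : Type} [Finite I] (z : O.Op I) (X : I → C) :
    tensorMap z (fun i => 𝟙 (X i)) = 𝟙 (tensorObj z X)
  tensorMap_comp {I : Type} [Finite I] (z : O.Op I) {X Y Z : I → C} (f : ∀ i, X i ⟶ Y i)
    (g : ∀ i, Y i ⟶ Z i) : tensorMap z (fun i => f i ≫ g i) = tensorMap z f ≫ tensorMap z g
  /-- The isomorphism `⊗_z ∘ e ≅ ⊗_{e · z}`. -/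
  permIso {I J : Type} [Finite I] [Finite J] (e : I ≃ J) {z : O.Op I} {z' : O.Op J}
    (h : O.relabel e z = z') (X : J → C) : tensorObj z (fun i => X (e i)) ≅ tensorObj z' X
  /-- The isomorphism `⊗_z ∘ (⊗_{x i})_i ≅ ⊗_{z ∘ x}`. -/
  compIso {I : Type} [Finite I] {K : I → Type} [∀ i, Finite (K i)] (z : O.Op I)
    (x : ∀ i, O.Op (K i)) (X : (Σ i, K i) → C) :
    tensorObj z (fun i => tensorObj (x i) (fun k => X ⟨i, k⟩)) ≅ tensorObj (O.comp z x) X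
  /-- The isomorphism `⊗_1 ≅ id`. -/
  unitIso (X : Unit → C) : tensorObj O.one X ≅ X ()
  permIso_naturality {I J : Type} [Finite I] [Finite J] (e : I ≃ J) {z : O.Op I} {z' : O.Op J}
    (h : O.relabel e z = z') {X Y : J → C} (f : ∀ j, X j ⟶ Y j) :
    tensorMap z (fun i => f (e i)) ≫ (permIso e h Y).hom = (permIso e h X).hom ≫ tensorMap z' f
  compIso_naturality {I : Type} [Finite I] {K : I → Type} [∀ i, Finite (K i)] (z : O.Op I)
    (x : ∀ i, O.Op (K i)) {X Y : (Σ i, K i) → C} (f : ∀ p, X p ⟶ Y p) :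
    tensorMap z (fun i => tensorMap (x i) (fun k => f ⟨i, k⟩)) ≫ (compIso z x Y).hom =
      (compIso z x X).hom ≫ tensorMap (O.comp z x) f
  unitIso_naturality {X Y : Unit → C} (f : ∀ t, X t ⟶ Y t) :
    tensorMap O.one f ≫ (unitIso Y).hom = (unitIso X).hom ≫ f ()
  permIso_refl {I : Type} [Finite I] (z : O.Op I) (X : I → C) :
    (permIso (Equiv.refl I) (O.relabel_refl z) X).hom = 𝟙 (tensorObj z X)
  permIso_trans {I J L : Type} [Finite I] [Finite J] [Finite L] (e : I ≃ J) (e' : J ≃ L)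
    (z : O.Op I) (X : L → C) :
    (permIso (e.trans e') (O.relabel_trans e e' z) X).hom =
      (permIso e rfl (fun j => X (e' j))).hom ≫ (permIso e' rfl X).hom
  compIso_permIso_left {I J : Type} [Finite I] [Finite J] {K : J → Type} [∀ j, Finite (K j)]
    (e : I ≃ J) (z : O.Op I) (x : ∀ j, O.Op (K j)) (X : (Σ j, K j) → C) :
    (permIso e rfl (fun j => tensorObj (x j) (fun k => X ⟨j, k⟩))).hom ≫
        (compIso (O.relabel e z) x X).hom =
      (compIso z (fun i => x (e i)) (fun p => X ⟨e p.1, p.2⟩)).hom ≫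
        (permIso (Equiv.sigmaCongrLeft e) (O.comp_relabel_left e z x) X).hom
  compIso_permIso_right {I : Type} [Finite I] {K L : I → Type} [∀ i, Finite (K i)]
    [∀ i, Finite (L i)] (e : ∀ i, K i ≃ L i) (z : O.Op I) (x : ∀ i, O.Op (K i))
    (X : (Σ i, L i) → C) :
    tensorMap z (fun i => (permIso (e i) rfl (fun l => X ⟨i, l⟩)).hom) ≫
        (compIso z (fun i => O.relabel (e i) (x i)) X).hom =
      (compIso z x (fun p => X ⟨p.1, e p.1 p.2⟩)).hom ≫
        (permIso (Equiv.sigmaCongrRight e) (O.comp_relabel_right e z x) X).hom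
  compIso_unit_left {K : Type} [Finite K] (x : O.Op K) (X : K → C) :
    (compIso O.one (fun _ => x) (fun p => X p.2)).hom ≫
        (permIso (unitSigma K) (O.one_comp x) X).hom =
      (unitIso (fun _ => tensorObj x X)).hom
  compIso_unit_right {I : Type} [Finite I] (z : O.Op I) (X : I → C) :
    (compIso z (fun _ => O.one) (fun p => X p.1)).hom ≫
        (permIso (sigmaUnit I) (O.comp_one z) X).hom =
      tensorMap z (fun i => (unitIso (fun _ => X i)).hom)
  compIso_assoc {I : Type} [Finite I] {K : I → Type} [∀ i, Finite (K i)] {L : ∀ i, K i → Type}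
    [∀ i k, Finite (L i k)] (z : O.Op I) (x : ∀ i, O.Op (K i)) (y : ∀ i k, O.Op (L i k))
    (X : (Σ i, Σ k, L i k) → C) :
    (compIso z x (fun p => tensorObj (y p.1 p.2) (fun l => X ⟨p.1, p.2, l⟩))).hom ≫
        (compIso (O.comp z x) (fun p => y p.1 p.2) (fun q => X ⟨q.1.1, q.1.2, q.2⟩)).hom ≫
        (permIso (Equiv.sigmaAssoc L) (O.assoc z x y) X).hom =
      tensorMap z (fun i => (compIso (x i) (y i) (fun q => X ⟨i, q⟩)).hom) ≫
        (compIso z (fun i => O.comp (x i) (y i)) X).hom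

open OMonoidal

/-- A lax `O`-monoidal functor. -/
structure LaxOFunctor (O : SymmOperad) (C : Type u₁) [Category.{v₁} C] [OMonoidal O C]
    (D : Type u₂) [Category.{v₂} D] [OMonoidal O D] extends C ⥤ D where
  lax {I : Type} [Finite I] (z : O.Op I) (X : I → C) :
    tensorObj z (fun i => obj (X i)) ⟶ obj (tensorObj z X)
  lax_naturality {I : Type} [Finite I] (z : O.Op I) {X Y : I → C} (f : ∀ i, X i ⟶ Y i) :
    tensorMap z (fun i => map (f i)) ≫ lax z Y = lax z X ≫ map (tensorMap z f)
  lax_perm {I J : Type} [Finite I] [Finite J] (e : I ≃ J) {z : O.Op I} {z' : O.Op J}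
    (h : O.relabel e z = z') (X : J → C) :
    (permIso e h (fun j => obj (X j))).hom ≫ lax z' X =
      lax z (fun i => X (e i)) ≫ map (permIso e h X).hom
  lax_comp {I : Type} [Finite I] {K : I → Type} [∀ i, Finite (K i)] (z : O.Op I)
    (x : ∀ i, O.Op (K i)) (X : (Σ i, K i) → C) :
    (compIso z x (fun p => obj (X p))).hom ≫ lax (O.comp z x) X =
      tensorMap z (fun i => lax (x i) (fun k => X ⟨i, k⟩)) ≫
        lax z (fun i => tensorObj (x i) (fun k => X ⟨i, k⟩)) ≫ map (compIso z x X).hom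
  lax_unit (X : Unit → C) :
    (unitIso (O := O) (fun t => obj (X t))).hom = lax O.one X ≫ map (unitIso X).hom

/-- A (strong) `O`-monoidal functor: the structure morphisms are isomorphisms. -/
structure OMonoidalFunctor (O : SymmOperad) (C : Type u₁) [Category.{v₁} C] [OMonoidal O C]
    (D : Type u₂) [Category.{v₂} D] [OMonoidal O D] extends LaxOFunctor O C D where
  isIso_lax {I : Type} [Finite I] (z : O.Op I) (X : I → C) : IsIso (lax z X)

/-! ### The trivial `O`-monoidal structures on `(Set, ×)` and on `(Fin, ⨿)` -/

/-- The trivial `O`-monoidal structure on sets given by cartesian products. -/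
instance typeOMonoidal (O : SymmOperad) : OMonoidal O (Type u) where
  tensorObj {I} _ _ X := ∀ i : I, X i
  tensorMap _ _ _ f := ↾fun s i => f i (s i)
  tensorMap_id _ _ := rfl
  tensorMap_comp _ _ _ _ _ _ := rfl
  permIso e _ _ _ X := (Equiv.piCongrLeft X e).toIso
  compIso _ _ X := (Equiv.piCurry (fun i k => X ⟨i, k⟩)).symm.toIso
  unitIso X := (Equiv.piUnique X).toIso
  permIso_naturality e _ _ _ _ _ f := by
    ext s j
    obtain ⟨i, rfl⟩ := e.surjective j
    exact (Equiv.piCongrLeft_apply_apply _ e _ i).trans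
      (congrArg (f (e i)) (Equiv.piCongrLeft_apply_apply _ e s i).symm)
  compIso_naturality _ _ _ _ _ := rfl
  unitIso_naturality _ := rfl
  permIso_refl _ _ := rfl
  permIso_trans e e' _ X := by
    ext s l
    obtain ⟨j, rfl⟩ := e'.surjective l
    obtain ⟨i, rfl⟩ := e.surjective j
    exact (Equiv.piCongrLeft_apply_apply X (e.trans e') s i).trans
      ((Equiv.piCongrLeft_apply_apply X e' _ (e i)).trans
        (Equiv.piCongrLeft_apply_apply (fun j => X (e' j)) e s i)).symm
  compIso_permIso_left {I J _ _ K _} e _ _ X := by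
    ext s ⟨j, k⟩
    obtain ⟨i, rfl⟩ := e.surjective j
    exact (congrFun (Equiv.piCongrLeft_apply_apply (fun j => ∀ k, X ⟨j, k⟩) e s i) k).trans
      (Equiv.piCongrLeft_apply_apply X (Equiv.sigmaCongrLeft (β := K) e)
        (Sigma.uncurry s) ⟨i, k⟩).symm
  compIso_permIso_right e _ _ X := by
    ext s ⟨i, l⟩
    obtain ⟨k, rfl⟩ := (e i).surjective l
    exact (Equiv.piCongrLeft_apply_apply (fun l => X ⟨i, l⟩) (e i) (s i) k).trans
      (Equiv.piCongrLeft_apply_apply X (Equiv.sigmaCongrRight e)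
        (Sigma.uncurry s) ⟨i, k⟩).symm
  compIso_unit_left {K _} _ X := by
    ext s k
    exact Equiv.piCongrLeft_apply_apply X (unitSigma K) (fun p => s p.1 p.2) ⟨(), k⟩
  compIso_unit_right {I _} _ X := by
    ext s i
    exact Equiv.piCongrLeft_apply_apply X (sigmaUnit I) (fun p => s p.1 p.2) ⟨i, ()⟩
  compIso_assoc {_ _ _ _ L _} _ _ _ X := by
    ext s ⟨i, k, l⟩
    exact Equiv.piCongrLeft_apply_apply X (Equiv.sigmaAssoc L)
      (fun q => s q.1.1 q.1.2 q.2) ⟨⟨i, k⟩, l⟩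

/-- The trivial `O`-monoidal structure on finite sets given by disjoint unions. -/
instance finOMonoidal (O : SymmOperad) : OMonoidal O FintypeCat.{u} where
  tensorObj {I} _ _ X := FintypeCat.of (Σ i : I, X i)
  tensorMap _ _ _ f := FintypeCat.homMk fun p => ⟨p.1, f p.1 p.2⟩
  tensorMap_id _ _ := rfl
  tensorMap_comp _ _ _ _ _ _ := rfl
  permIso e _ _ _ X := FintypeCat.equivEquivIso (Equiv.sigmaCongrLeft (β := fun j => X j) e)
  compIso _ _ X := FintypeCat.equivEquivIso (Equiv.sigmaAssoc (fun i k => X ⟨i, k⟩)).symm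
  unitIso X := FintypeCat.equivEquivIso (Equiv.uniqueSigma (fun t => X t))
  permIso_naturality _ _ _ _ _ _ _ := rfl
  compIso_naturality _ _ _ _ _ := rfl
  unitIso_naturality _ := rfl
  permIso_refl _ _ := rfl
  permIso_trans _ _ _ _ := rfl
  compIso_permIso_left _ _ _ _ := rfl
  compIso_permIso_right _ _ _ _ := rfl
  compIso_unit_left _ _ := rfl
  compIso_unit_right _ _ := rfl
  compIso_assoc _ _ _ _ := rfl

/-! ### Convex sets and the convex Grothendieck construction -/

/-- A map out of a product of convex sets is `n`-convex if it is convex in each variable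
separately. -/
def IsMultiConvex {I : Type} {X : I → Type u} {Y : Type v} [∀ i, ConvexSpace ℝ≥0 (X i)]
    [ConvexSpace ℝ≥0 Y] (f : (∀ i, X i) → Y) : Prop :=
  open Classical in
  ∀ (i : I) (s : ∀ i, X i), IsAffineMap ℝ≥0 fun x => f (Function.update s i x)

/-- A lax `O`-monoidal functor from `C` to `(CSet, ⊗)`, where `⊗` is the tensor product of convex
sets. Since `⊗` classifies `n`-convex maps, this is a lax `O`-monoidal functor to `(Set, ×)`
together with a lift of the underlying functor to convex sets, such that all the structure maps are
`n`-convex. -/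
structure ConvexLaxOFunctor (O : SymmOperad) (C : Type u) [Category.{v} C] [OMonoidal O C] extends
    LaxOFunctor O C (Type w) where
  convex (c : C) : ConvexSpace ℝ≥0 (obj c)
  map_convex {c d : C} (f : c ⟶ d) : IsAffineMap ℝ≥0 (map f : obj c → obj d)
  lax_multiConvex {I : Type} [Finite I] (z : O.Op I) (X : I → C) :
    IsMultiConvex (X := fun i => obj (X i)) (lax z X : (∀ i, obj (X i)) → obj (tensorObj z X))

/-- The category underlying the convex `O`-monoidal Grothendieck construction `∫ G`: objects are
pairs `(c, x)` with `x ∈ G c`, morphisms `(c, x) ⟶ (d, y)` are morphisms `f : c ⟶ d` with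
`G f x = y`. -/
def ConvexLaxOFunctor.Grothendieck {O : SymmOperad} {C : Type u} [Category.{v} C] [OMonoidal O C]
    (G : ConvexLaxOFunctor.{w} O C) : Type (max u w) :=
  G.toFunctor.Elements

section Grothendieck

variable {O : SymmOperad} {C : Type u} [Category.{v} C] [OMonoidal O C]
  (G : ConvexLaxOFunctor.{w} O C)

instance : Category.{v} G.Grothendieck := inferInstanceAs (Category G.toFunctor.Elements)

/-- The projection `∫ G ⥤ C`. -/
def ConvexLaxOFunctor.proj : G.Grothendieck ⥤ C := CategoryOfElements.π G.toFunctor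

/-- The `O`-monoidal structure of the Grothendieck construction:
`⊗_z (cᵢ, xᵢ) = (⊗_z cᵢ, ξ_z (xᵢ))`, with structure isomorphisms those of `C`. -/
instance ConvexLaxOFunctor.grothendieckOMonoidal : OMonoidal O G.Grothendieck where
  tensorObj z X := ⟨tensorObj z fun i => (X i).1, G.lax z (fun i => (X i).1) fun i => (X i).2⟩
  tensorMap z X Y f := ⟨tensorMap z fun i => (f i).1, by
    have h := ConcreteCategory.congr_hom (G.lax_naturality z fun i => (f i).1) fun i => (X i).2
    refine h.symm.trans ?_
    exact congrArg (G.lax z _) (funext fun i => (f i).2)⟩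
  tensorMap_id z X := Subtype.ext (tensorMap_id z _)
  tensorMap_comp z X Y Z f g := Subtype.ext (tensorMap_comp z _ _)
  permIso e z z' h X := CategoryOfElements.isoMk _ _ (permIso e h fun j => (X j).1) (by
    have h' := ConcreteCategory.congr_hom (G.lax_perm e h fun j => (X j).1) fun i => (X (e i)).2
    refine h'.symm.trans (congrArg (G.lax z' _) ?_)
    exact (Equiv.piCongrLeft (fun j => G.obj (X j).1) e).apply_symm_apply fun j => (X j).2)
  compIso z x X := CategoryOfElements.isoMk _ _ (compIso z x fun p => (X p).1)
    (ConcreteCategory.congr_hom (G.lax_comp z x fun p => (X p).1) fun i k => (X ⟨i, k⟩).2).symm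
  unitIso X := CategoryOfElements.isoMk _ _ (unitIso fun t => (X t).1)
    (ConcreteCategory.congr_hom (G.lax_unit fun t => (X t).1) fun t => (X t).2).symm
  permIso_naturality e z z' h X Y f := Subtype.ext (permIso_naturality e h fun j => (f j).1)
  compIso_naturality z x X Y f := Subtype.ext (compIso_naturality z x fun p => (f p).1)
  unitIso_naturality f := Subtype.ext (unitIso_naturality _)
  permIso_refl z X := Subtype.ext (permIso_refl z _)
  permIso_trans e e' z X := Subtype.ext (permIso_trans e e' z fun l => (X l).1)
  compIso_permIso_left e z x X := Subtype.ext (compIso_permIso_left e z x fun p => (X p).1)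
  compIso_permIso_right e z x X := Subtype.ext (compIso_permIso_right e z x fun p => (X p).1)
  compIso_unit_left x X := Subtype.ext (compIso_unit_left x fun k => (X k).1)
  compIso_unit_right z X := Subtype.ext (compIso_unit_right z fun i => (X i).1)
  compIso_assoc z x y X := Subtype.ext (compIso_assoc z x y fun p => (X p).1)

end Grothendieck

/-! ### Distributions and `FinProb` -/

/-- The lax `QConv`-monoidal functor `(Dist, ξ) : (Fin, ⨿) ⥤ (CSet, ⊗)`: `Dist X` is the convex
set of probability distributions on `X`, maps act by pushforward, and
`ξ_α (p₁, …, pₙ) = ∑ αᵢ pᵢ`, where `pᵢ` is viewed as a distribution on `X₁ ⨿ ⋯ ⨿ Xₙ` concentrated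
on the summand `Xᵢ`. -/
def distFunctor : ConvexLaxOFunctor.{u} QConv FintypeCat.{u} where
  obj X := StdSimplex ℝ≥0 X
  map f := ↾StdSimplex.map f
  map_id _ := by
    refine ConcreteCategory.hom_ext _ _ fun p => ?_
    exact StdSimplex.map_id p
  map_comp f g := by
    refine ConcreteCategory.hom_ext _ _ fun p => ?_
    exact StdSimplex.map_comp p f g
  lax α _ := ↾fun p => mixture α p
  lax_naturality α _ _ f := by
    refine ConcreteCategory.hom_ext _ _ fun p => ?_
    exact mixture_map α p fun i => f i
  lax_perm e α _ h X := by
    subst h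
    refine ConcreteCategory.hom_ext _ _ fun p => ?_
    obtain ⟨q, rfl⟩ := (Equiv.piCongrLeft (fun j => StdSimplex ℝ≥0 (X j)) e).symm.surjective p
    refine Eq.trans ?_ (mixture_relabel e α q)
    exact congrArg (mixture _) (Equiv.apply_symm_apply _ q)
  lax_comp α β X := by
    refine ConcreteCategory.hom_ext _ _ fun p => ?_
    exact mixture_mixture (X := fun q => X q) α β p
  lax_unit X := by
    refine ConcreteCategory.hom_ext _ _ fun p => ?_
    exact (mixture_single (X := fun t => X t) p (Equiv.uniqueSigma fun t => X t)
      fun _ => rfl).symm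
  convex X := (inferInstance : ConvexSpace ℝ≥0 (StdSimplex ℝ≥0 X))
  map_convex {X Y} f := StdSimplex.isAffineMap_map ℝ≥0 (f : X → Y)
  lax_multiConvex α X i p := by
    classical
    exact mixture_update (X := fun i => X i) α p i

/-- The category of finite probability spaces: objects are pairs `(X, p)` of a finite set and a
probability distribution on it, morphisms are measure preserving functions. -/
abbrev FinProb : Type (u + 1) := distFunctor.{u}.Grothendieck

/-- The finite probability space `(X, p)`. -/
def FinProb.of (X : FintypeCat.{u}) (p : StdSimplex ℝ≥0 X) : FinProb.{u} := ⟨X, p⟩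

/-- The underlying finite set of a finite probability space. -/
def FinProb.carrier (P : FinProb.{u}) : FintypeCat.{u} := P.1

/-- The probability distribution of a finite probability space. -/
def FinProb.prob (P : FinProb.{u}) : StdSimplex ℝ≥0 (FinProb.carrier P) := P.2

/-- Shannon entropy `H(X, p) = -∑ p(x) ln p(x)`, with the convention `0 ln 0 = 0`. -/
def shannonEntropy (P : FinProb.{u}) : ℝ :=
  -(FinProb.prob P).weights.sum fun _ r => (r : ℝ) * Real.log r

/-! ### The one-object category `Bℝ≥0` -/

/-- The one-object category with morphisms the additive monoid of non-negative reals. -/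
abbrev BNNReal : Type := SingleObj (Multiplicative ℝ≥0)

namespace BNNReal

/-- The non-negative real underlying a morphism of `Bℝ≥0`. -/
def val {x y : BNNReal} (f : x ⟶ y) : ℝ≥0 :=
  Multiplicative.toAdd (show Multiplicative ℝ≥0 from f)

/-- The morphism of `Bℝ≥0` given by a non-negative real. -/
def ofNNReal (x y : BNNReal) (r : ℝ≥0) : x ⟶ y :=
  show Multiplicative ℝ≥0 from Multiplicative.ofAdd r

theorem hom_ext {x y : BNNReal} {f g : x ⟶ y} (h : val f = val g) : f = g := h

theorem val_comp {x y z : BNNReal} (f : x ⟶ y) (g : y ⟶ z) : val (f ≫ g) = val f + val g :=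
  add_comm _ _

theorem val_id (x : BNNReal) : val (𝟙 x) = 0 := rfl

/-- The weighted sum `∑ αᵢ rᵢ`. -/
def weightedSum {I : Type} (α : StdSimplex ℝ≥0 I) (r : I → ℝ≥0) : ℝ≥0 :=
  α.weights.sum fun i a => a * r i

theorem weightedSum_map {I J : Type} (e : I → J) (α : StdSimplex ℝ≥0 I) (r : J → ℝ≥0) :
    weightedSum (α.map e) r = weightedSum α fun i => r (e i) := by
  simp [weightedSum, Finsupp.sum_mapDomain_index, add_mul]

theorem weightedSum_comp {I : Type} {K : I → Type} (α : StdSimplex ℝ≥0 I)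
    (β : ∀ i, StdSimplex ℝ≥0 (K i)) (r : (Σ i, K i) → ℝ≥0) :
    weightedSum (mixture α β) r =
      weightedSum α fun i => weightedSum (β i) fun k => r ⟨i, k⟩ := by
  have h (i : I) (a : ℝ≥0) :
      ((β i).weights.mapDomain (Sigma.mk i)).sum (fun p b => a * b * r p) =
        (β i).weights.sum fun k b => a * (b * r ⟨i, k⟩) := by
    rw [Finsupp.sum_mapDomain_index (by simp) (by intros; ring)]
    simp only [mul_assoc]
  simp [weightedSum, mixture, iConvexComb, Finsupp.sum_mapDomain_index, add_smul, add_mul,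
    Finsupp.sum_sum_index, Finsupp.sum_smul_index, Finsupp.mul_sum, h]

theorem ofNNReal_weightedSum_zero {I : Type} (α : StdSimplex ℝ≥0 I) (x : BNNReal) :
    ofNNReal x x (weightedSum α fun _ => 0) = 𝟙 x :=
  hom_ext (show weightedSum α (fun _ => 0) = 0 by simp [weightedSum])

/-- The strict `QConv`-monoidal structure on `Bℝ≥0` given by convex combinations:
`⊗_α (r₁, …, rₙ) = ∑ αᵢ rᵢ`. -/
instance instOMonoidal : OMonoidal QConv BNNReal where
  tensorObj _ _ := SingleObj.star _
  tensorMap α _ _ f := ofNNReal _ _ (weightedSum α fun i => val (f i))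
  tensorMap_id α _ := ofNNReal_weightedSum_zero α _
  tensorMap_comp α _ _ _ f g := hom_ext (by
    simp [weightedSum, val_comp, mul_add, Finsupp.sum_add]; rfl)
  permIso _ _ _ _ _ := Iso.refl _
  compIso _ _ _ := Iso.refl _
  unitIso _ := Iso.refl (SingleObj.star _)
  permIso_naturality e α _ h _ _ f := by
    subst h
    refine (Category.comp_id _).trans (Eq.trans ?_ (Category.id_comp _).symm)
    exact hom_ext (weightedSum_map e α fun j => val (f j)).symm
  compIso_naturality α β _ _ f := by
    refine (Category.comp_id _).trans (Eq.trans ?_ (Category.id_comp _).symm)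
    exact hom_ext (weightedSum_comp α β fun p => val (f p)).symm
  unitIso_naturality f := by
    refine (Category.comp_id _).trans (Eq.trans ?_ (Category.id_comp _).symm)
    exact hom_ext (show weightedSum (StdSimplex.single ()) (fun t => val (f t)) = val (f ()) by
      simp [weightedSum])
  permIso_refl _ _ := rfl
  permIso_trans _ _ _ _ := (Category.id_comp _).symm
  compIso_permIso_left _ _ _ _ := rfl
  compIso_permIso_right _ α _ _ := congrArg (· ≫ 𝟙 _) (ofNNReal_weightedSum_zero α _)
  compIso_unit_left _ _ := Category.id_comp _
  compIso_unit_right α _ := (Category.id_comp _).trans (ofNNReal_weightedSum_zero α _).symm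
  compIso_assoc α _ _ _ :=
    (Category.id_comp _).trans (congrArg (· ≫ 𝟙 _) (ofNNReal_weightedSum_zero α _).symm)

end BNNReal

/-! ### Fibrewise topological categories and continuity -/

/-- The strict fibre `π⁻¹(f)` of a functor over a morphism `f`. -/
structure HomFiber {C : Type u₁} [Category.{v₁} C] {J : Type u₂} [Category.{v₂} J] (π : C ⥤ J)
    {i j : J} (f : i ⟶ j) where
  src : C
  tgt : C
  hom : src ⟶ tgt
  isHomLift : π.IsHomLift f hom

namespace HomFiber

variable {C : Type u₁} [Category.{v₁} C] {J : Type u₂} [Category.{v₂} J] {π : C ⥤ J}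
  {i j : J} {f : i ⟶ j}

/-- The source map `π⁻¹(f) → π⁻¹(i)`. -/
def source (φ : HomFiber π f) : π.Fiber i :=
  ⟨φ.src, have := φ.isHomLift; IsHomLift.domain_eq π f φ.hom⟩

/-- The target map `π⁻¹(f) → π⁻¹(j)`. -/
def target (φ : HomFiber π f) : π.Fiber j :=
  ⟨φ.tgt, have := φ.isHomLift; IsHomLift.codomain_eq π f φ.hom⟩

end HomFiber

/-- The structure of a fibrewise topological category on `C` with respect to `π : C ⥤ J`. -/
structure FibrewiseTopology {C : Type u₁} [Category.{v₁} C] {J : Type u₂} [Category.{v₂} J]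
    (π : C ⥤ J) where
  objTop (i : J) : TopologicalSpace (π.Fiber i)
  homTop {i j : J} (f : i ⟶ j) : TopologicalSpace (HomFiber π f)
  continuous_source {i j : J} (f : i ⟶ j) :
    @Continuous _ _ (homTop f) (objTop i) (HomFiber.source (f := f))
  continuous_target {i j : J} (f : i ⟶ j) :
    @Continuous _ _ (homTop f) (objTop j) (HomFiber.target (f := f))

section Continuity

variable {C : Type u₁} [Category.{v₁} C] {J : Type u₂} [Category.{v₂} J] {π : C ⥤ J}
  {D : Type u₃} [Category.{v₃} D] {K : Type u₄} [Category.{v₄} K] {θ : D ⥤ K}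

/-- The map `π⁻¹(i) → θ⁻¹(T i)` induced by a commutative square of functors. -/
def fiberMap (F : C ⥤ D) (T : J ⥤ K) (sq : F ⋙ θ = π ⋙ T) (i : J) (a : π.Fiber i) :
    θ.Fiber (T.obj i) :=
  ⟨F.obj a.1, (Functor.congr_obj sq a.1).trans (congrArg T.obj a.2)⟩

theorem isHomLift_map_of_sq (F : C ⥤ D) (T : J ⥤ K) (sq : F ⋙ θ = π ⋙ T) {i j : J} {f : i ⟶ j}
    {a b : C} {φ : a ⟶ b} (h : π.IsHomLift f φ) : θ.IsHomLift (T.map f) (F.map φ) := by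
  induction h with
  | map φ =>
    exact IsHomLift.of_fac' θ _ (F.map φ) (Functor.congr_obj sq _) (Functor.congr_obj sq _)
      (Functor.congr_hom sq φ)

/-- The map `π⁻¹(f) → θ⁻¹(T f)` induced by a commutative square of functors. -/
def homFiberMap (F : C ⥤ D) (T : J ⥤ K) (sq : F ⋙ θ = π ⋙ T) {i j : J} (f : i ⟶ j)
    (φ : HomFiber π f) : HomFiber θ (T.map f) where
  src := F.obj φ.src
  tgt := F.obj φ.tgt
  hom := F.map φ.hom
  isHomLift := isHomLift_map_of_sq F T sq φ.isHomLift

/-- A functor `F : C ⥤ D` between fibrewise topological categories is continuous if it is part of a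
commutative square of functors which induces continuous maps on the fibres over all objects and over
all morphisms. -/
def IsFibrewiseContinuous (τ : FibrewiseTopology π) (σ : FibrewiseTopology θ) (F : C ⥤ D) : Prop :=
  ∃ (T : J ⥤ K) (sq : F ⋙ θ = π ⋙ T),
    (∀ i, @Continuous _ _ (τ.objTop i) (σ.objTop (T.obj i)) (fiberMap F T sq i)) ∧
    ∀ {i j : J} (f : i ⟶ j),
      @Continuous _ _ (τ.homTop f) (σ.homTop (T.map f)) (homFiberMap F T sq f)

end Continuity

/-- The fibrewise topology on a Grothendieck construction `∫ G`, when the sets `G c` are topological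
spaces: `π⁻¹(c) = G c`, and for `f : c ⟶ d` the set `π⁻¹(f) ⊆ G c × G d` carries the subspace
topology. -/
def grothendieckTopology {O : SymmOperad} {C : Type u} [Category.{v} C] [OMonoidal O C]
    (G : ConvexLaxOFunctor.{w} O C) (t : ∀ c, TopologicalSpace (G.obj c)) :
    FibrewiseTopology G.proj :=
  let objTop (c : C) : TopologicalSpace (G.proj.Fiber c) :=
    (t c).induced fun a => G.map (eqToHom a.2) a.1.2
  { objTop := objTop
    homTop := fun {c d} f =>
      (@instTopologicalSpaceProd _ _ (objTop c) (objTop d)).induced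
        fun φ : HomFiber G.proj f => (φ.source, φ.target)
    continuous_source := fun {c d} f => by
      let _ := objTop c
      let _ := objTop d
      exact @Continuous.comp _ _ _ (_) _ _ _ _ continuous_fst
        (continuous_induced_dom (f := fun φ : HomFiber G.proj f => (φ.source, φ.target)))
    continuous_target := fun {c d} f => by
      let _ := objTop c
      let _ := objTop d
      exact @Continuous.comp _ _ _ (_) _ _ _ _ continuous_snd
        (continuous_induced_dom (f := fun φ : HomFiber G.proj f => (φ.source, φ.target))) }

/-- The topology on the set of distributions on `X` as a subspace of `ℝ^X`. -/
@[reducible] def distTopology (X : FintypeCat.{u}) : TopologicalSpace (distFunctor.obj X) :=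
  TopologicalSpace.induced (X := StdSimplex ℝ≥0 X) (Y := X → ℝ≥0) (fun p x => p.weights x)
    inferInstance

/-- `FinProb` as a fibrewise topological category over the category of finite sets. -/
def finProbTopology : FibrewiseTopology distFunctor.{u}.proj := grothendieckTopology distFunctor distTopology

/-- `Bℝ≥0` as a fibrewise topological category over the terminal category: the set of all morphisms
carries the usual topology of `ℝ≥0`. -/
def BNNReal.topology : FibrewiseTopology (Functor.star.{0} BNNReal) where
  objTop _ := ⊤
  homTop _ := TopologicalSpace.induced (fun φ => BNNReal.val φ.hom) inferInstance
  continuous_source _ := continuous_top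
  continuous_target _ := continuous_top

end

/-! Every space has exactly one morphism to the one-point space; let E(P) be the value of F on it.
Functoriality along P → Q → pt gives F(f) = E(P) - E(Q), so it remains to show that E is a multiple
of Shannon entropy.

The structure isomorphisms of F have value 0, since 0 is the only invertible element of ℝ≥0. Hence F
turns ⊗_α into a convex combination, and applying it to ⊗_α of the maps Xᵢ → pt, whose target is (I,
α), yields the chain rule for E (`entropyOf_mixture`). Continuity of F over X → pt makes E
continuous.

Faddeev's argument then applies (`IsFaddeevEntropy.eq_entropy`). Let φ(n) be the entropy of the
uniform distribution on n points. Cutting these points into blocks gives φ(mn) = φ(m) + φ(n), and,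
with continuity at a point mass and φ ≥ 0, φ(n+1) - φ(n) → 0. These two properties force φ = c ln
(`completelyAdditive_eq_log`). The chain rule then determines E on distributions with positive
rational weights, and continuity extends the formula to all. -/

/-! ### Completely additive arithmetic functions with vanishing differences -/

section CompletelyAdditive

open Filter Topology

variable {φ : ℕ → ℝ}

theorem completelyAdditive_pow (hmul : ∀ m n, m ≠ 0 → n ≠ 0 → φ (m * n) = φ m + φ n)
    {n : ℕ} (hn : n ≠ 0) (k : ℕ) : φ (n ^ k) = k * φ n := by
  induction k with
  | zero =>
    have := hmul 1 1 one_ne_zero one_ne_zero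
    simp only [mul_one] at this
    simp; linarith
  | succ k ih =>
    rw [pow_succ, hmul _ _ (pow_ne_zero _ hn) hn, ih]; push_cast; ring

/-- A completely additive function with vanishing differences and `φ 2 = 0` grows more slowly than
any multiple of the logarithm. -/
theorem completelyAdditive_abs_le (hmul : ∀ m n, m ≠ 0 → n ≠ 0 → φ (m * n) = φ m + φ n)
    (hlim : Tendsto (fun n => φ (n + 1) - φ n) atTop (𝓝 0)) (h2 : φ 2 = 0)
    {ε : ℝ} (hε : 0 < ε) : ∃ M : ℝ, ∀ n, |φ n| ≤ M + ε * Nat.log 2 n := by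
  obtain ⟨N, hN⟩ := Metric.tendsto_atTop.1 hlim ε hε
  -- This constant covers all n < N + 2; beyond that, n / 2 is nonzero and n - 1 ≥ N.
  refine ⟨∑ i ∈ Finset.range (N + 2), |φ i|, fun n => ?_⟩
  induction n using Nat.strong_induction_on with
  | _ n ih =>
    by_cases hn : n < N + 2
    · have h := Finset.single_le_sum (f := fun i => |φ i|) (fun i _ => abs_nonneg _)
        (Finset.mem_range.2 hn)
      have : 0 ≤ ε * Nat.log 2 n := by positivity
      linarith
    · have hlog : Nat.log 2 n = Nat.log 2 (n / 2) + 1 :=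
        Nat.log_of_one_lt_of_le (by norm_num) (by omega)
      have h0 : n / 2 ≠ 0 := by omega
      -- Since φ 2 = 0, doubling is free; an odd n costs one difference, less than ε. The number of
      -- halvings is bounded by `Nat.log 2 n`.
      have key : |φ n| ≤ |φ (n / 2)| + ε := by
        have hd := hmul 2 (n / 2) two_ne_zero h0
        rw [h2, zero_add] at hd
        rcases Nat.even_or_odd' n with ⟨q, hq | hq⟩
        · have : 2 * (n / 2) = n := by omega
          rw [this] at hd
          rw [hd]; linarith
        · have h1 : 2 * (n / 2) = n - 1 := by omega
          have h3 := hN (n - 1) (by omega)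
          rw [Nat.sub_add_cancel (by omega), dist_zero_right, Real.norm_eq_abs] at h3
          rw [h1] at hd
          rw [← hd]
          have := abs_sub_abs_le_abs_sub (φ n) (φ (n - 1))
          linarith
      have := ih (n / 2) (by omega)
      rw [hlog]; push_cast
      linarith

/-- Tensor-power trick: the bound at n ^ k reads k |φ n| ≤ M + ε k log₂ n. Dividing by k removes M
as k → ∞, and then ε → 0. -/
theorem completelyAdditive_eq_zero (hmul : ∀ m n, m ≠ 0 → n ≠ 0 → φ (m * n) = φ m + φ n)
    (hlim : Tendsto (fun n => φ (n + 1) - φ n) atTop (𝓝 0)) (h2 : φ 2 = 0)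
    {n : ℕ} (hn : n ≠ 0) : φ n = 0 := by
  have hL : 0 ≤ Real.logb 2 n :=
    Real.logb_nonneg one_lt_two (by exact_mod_cast Nat.one_le_iff_ne_zero.2 hn)
  have hbound (ε : ℝ) (hε : 0 < ε) : |φ n| ≤ ε * Real.logb 2 n := by
    obtain ⟨M, hM⟩ := completelyAdditive_abs_le hmul hlim h2 hε
    by_contra! hlt
    obtain ⟨k, hk⟩ := exists_nat_gt (M / (|φ n| - ε * Real.logb 2 n))
    rw [div_lt_iff₀ (by linarith)] at hk
    have h1 := hM (n ^ k)
    rw [completelyAdditive_pow hmul hn, abs_mul, Nat.abs_cast] at h1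
    have h3 : (Nat.log 2 (n ^ k) : ℝ) ≤ k * Real.logb 2 n := by
      have := Real.natLog_le_logb (n ^ k) 2
      rwa [Nat.cast_pow, Real.logb_pow, Nat.cast_ofNat] at this
    have := mul_le_mul_of_nonneg_left h3 hε.le
    linarith
  rw [← abs_nonpos_iff]
  refine le_of_forall_pos_le_add fun δ hδ => ?_
  -- The `+ 1` keeps the denominator positive when n = 1.
  have h := hbound (δ / (Real.logb 2 n + 1)) (by positivity)
  rw [div_mul_eq_mul_div, le_div_iff₀ (by positivity)] at h
  nlinarith [abs_nonneg (φ n)]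

/-- A completely additive function with vanishing differences is a multiple of the logarithm. -/
theorem completelyAdditive_eq_log (hmul : ∀ m n, m ≠ 0 → n ≠ 0 → φ (m * n) = φ m + φ n)
    (hlim : Tendsto (fun n => φ (n + 1) - φ n) atTop (𝓝 0)) {n : ℕ} (hn : n ≠ 0) :
    φ n = φ 2 / Real.log 2 * Real.log n := by
  have h2 : Real.log 2 ≠ 0 := (Real.log_pos one_lt_two).ne'
  -- Subtracting the multiple of log that agrees with φ at 2 preserves both hypotheses and makes the
  -- value at 2 vanish.
  refine sub_eq_zero.1 (completelyAdditive_eq_zero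
    (φ := fun n => φ n - φ 2 / Real.log 2 * Real.log n) (fun m n hm hn => ?_) ?_ ?_ hn)
  · rw [hmul m n hm hn, Nat.cast_mul, Real.log_mul (by exact_mod_cast hm) (by exact_mod_cast hn)]
    ring
  · have hl : Tendsto (fun n : ℕ => Real.log (n + 1 : ℕ) - Real.log n) atTop (𝓝 0) := by
      have := Real.tendsto_log_nat_add_one_sub_log
      simpa using this
    have := hlim.sub (hl.const_mul (φ 2 / Real.log 2))
    rw [mul_zero, sub_zero] at this
    refine this.congr fun n => ?_
    ring
  · simp [h2]

/-- If `φ (n + 1) - n / (n + 1) φ n → 0` then `φ (n + 1) - φ n → 0`, for non-negative `φ`. -/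
theorem tendsto_sub_of_tendsto_sub_mul (h0 : ∀ n, 0 ≤ φ n) (d : ℕ → ℝ)
    (hd : Tendsto d atTop (𝓝 0)) (h : ∀ n : ℕ, φ (n + 1) = n / (n + 1) * φ n + d n) :
    Tendsto (fun n => φ (n + 1) - φ n) atTop (𝓝 0) := by
  -- As n / (n + 1) ≤ 1 and φ ≥ 0, the recursion can be summed; the Cesàro means of d tend to 0, so
  -- φ n = o(n).
  have hle (n : ℕ) : φ n ≤ φ 0 + ∑ i ∈ Finset.range n, d i := by
    induction n with
    | zero => simp
    | succ n ih =>
      rw [Finset.sum_range_succ, h n]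
      have : (n / (n + 1) : ℝ) * φ n ≤ 1 * φ n :=
        mul_le_mul_of_nonneg_right ((div_le_one (by positivity)).2 (by linarith)) (h0 n)
      linarith
  have hdiv : Tendsto (fun n : ℕ => (n⁻¹ : ℝ) * φ n) atTop (𝓝 0) := by
    have hup : Tendsto (fun n : ℕ => (n⁻¹ : ℝ) * φ 0 + (n⁻¹ : ℝ) * ∑ i ∈ Finset.range n, d i)
        atTop (𝓝 0) := by
      simpa using (tendsto_inv_atTop_nhds_zero_nat (𝕜 := ℝ)).mul_const (φ 0) |>.add hd.cesaro
    refine squeeze_zero (fun n => mul_nonneg (by positivity) (h0 n)) (fun n => ?_) hup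
    rw [← mul_add]
    exact mul_le_mul_of_nonneg_left (hle n) (by positivity)
  have hdiv' : Tendsto (fun n : ℕ => (1 / (n + 1) : ℝ) * φ n) atTop (𝓝 0) := by
    refine squeeze_zero' (.of_forall fun n => mul_nonneg (by positivity) (h0 n)) ?_ hdiv
    filter_upwards [eventually_gt_atTop 0] with n hn
    refine mul_le_mul_of_nonneg_right ?_ (h0 n)
    rw [← one_div]
    exact one_div_le_one_div_of_le (by exact_mod_cast hn) (by linarith)
  -- The recursion says φ (n + 1) - φ n = d n - φ n / (n + 1).
  have := hd.sub hdiv'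
  rw [sub_zero] at this
  refine this.congr fun n => ?_
  rw [h n]
  field_simp
  ring

end CompletelyAdditive

/-! ### Uniform distributions, rational distributions and weights of mixtures -/

namespace Convexity.StdSimplex

/-- The distribution proportional to `k`. -/
noncomputable def ofCounts {X : Type u} [Fintype X] (k : X → ℕ) (hk : ∑ x, k x ≠ 0) :
    StdSimplex ℝ≥0 X where
  weights := Finsupp.equivFunOnFinite.symm fun x => (k x : ℝ≥0) / ∑ x, (k x : ℝ≥0)
  nonneg _ := zero_le
  total := by
    rw [Finsupp.sum_fintype _ _ fun _ => rfl]
    simp only [Finsupp.equivFunOnFinite_symm_apply_apply]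
    rw [← Finset.sum_div, div_self (by exact_mod_cast hk)]

theorem ofCounts_weights {X : Type u} [Fintype X] (k : X → ℕ) (hk : ∑ x, k x ≠ 0) (x : X) :
    (ofCounts k hk).weights x = (k x : ℝ≥0) / ∑ x, (k x : ℝ≥0) := rfl

/-- The uniform distribution. -/
noncomputable def uniform (X : Type u) [Fintype X] [Nonempty X] : StdSimplex ℝ≥0 X :=
  ofCounts (fun _ => 1) (by simp)

theorem uniform_weights (X : Type u) [Fintype X] [Nonempty X] (x : X) :
    (uniform X).weights x = (Fintype.card X : ℝ≥0)⁻¹ := by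
  simp [uniform, ofCounts_weights]

theorem ext_weights {X : Type u} {p q : StdSimplex ℝ≥0 X} (h : ∀ x, p.weights x = q.weights x) :
    p = q :=
  StdSimplex.ext (Finsupp.ext h)

theorem map_equiv_weights {X : Type u} {Y : Type v} (e : X ≃ Y) (p : StdSimplex ℝ≥0 X) (y : Y) :
    (p.map e).weights y = p.weights (e.symm y) := by
  obtain ⟨x, rfl⟩ := e.surjective y
  rw [weights_map, Finsupp.mapDomain_apply e.injective, e.symm_apply_apply]

theorem uniform_map {X : Type u} {Y : Type v} [Fintype X] [Nonempty X] [Fintype Y] [Nonempty Y]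
    (e : X ≃ Y) : (uniform X).map e = uniform Y :=
  ext_weights fun y => by rw [map_equiv_weights, uniform_weights, uniform_weights,
    Fintype.card_congr e]

theorem mixture_weights {I : Type} {X : I → Type u} (α : StdSimplex ℝ≥0 I)
    (p : ∀ i, StdSimplex ℝ≥0 (X i)) (i : I) (x : X i) :
    (mixture α p).weights ⟨i, x⟩ = α.weights i * (p i).weights x := by
  classical
  have h : (mixture α p).weights ⟨i, x⟩ =
      α.weights.sum fun j a => a * ((p j).weights.mapDomain (Sigma.mk j)) ⟨i, x⟩ := by
    simp [mixture, iConvexComb, Finsupp.sum_mapDomain_index, add_smul, Finsupp.sum_apply]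
  rw [h, Finsupp.sum, Finset.sum_eq_single i]
  · rw [Finsupp.mapDomain_apply sigma_mk_injective]
  · intro j _ hj
    rw [Finsupp.mapDomain_of_notMem_range, mul_zero]
    rintro ⟨y, hy⟩
    exact hj (Sigma.mk.inj hy).1
  · intro hi
    rw [Finsupp.notMem_support_iff.1 hi, zero_mul]

/-- Each point of block i has weight (|Xᵢ| / N) · (1 / |Xᵢ|) = 1 / N, where N is the total number of
points. -/
theorem mixture_uniform {I : Type} [Fintype I] {X : I → Type} [∀ i, Fintype (X i)]
    [∀ i, Nonempty (X i)] [Nonempty (Σ i, X i)] (h : ∑ i, Fintype.card (X i) ≠ 0) :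
    mixture (ofCounts (fun i => Fintype.card (X i)) h) (fun i => uniform (X i)) =
      uniform (Σ i, X i) := by
  refine ext_weights fun ⟨i, x⟩ => ?_
  rw [mixture_weights, ofCounts_weights, uniform_weights, uniform_weights, Fintype.card_sigma]
  have : (Fintype.card (X i) : ℝ≥0) ≠ 0 := by simp
  push_cast
  field_simp

end Convexity.StdSimplex

/-! ### Faddeev's characterisation of entropy -/

section Faddeev

open Filter Topology Convexity.StdSimplex

/-- Non-negative, symmetric and continuous functions on finite distributions which satisfy the chain
rule of entropy and vanish on point masses. -/
structure IsFaddeevEntropy (E : ∀ (X : Type) [Finite X], StdSimplex ℝ≥0 X → ℝ) : Prop where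
  nonneg {X : Type} [Finite X] (p : StdSimplex ℝ≥0 X) : 0 ≤ E X p
  map_equiv {X Y : Type} [Finite X] [Finite Y] (e : X ≃ Y) (p : StdSimplex ℝ≥0 X) :
    E Y (p.map e) = E X p
  single {X : Type} [Finite X] (x : X) : E X (StdSimplex.single x) = 0
  chain {I : Type} [Finite I] {X : I → Type} [∀ i, Finite (X i)] (α : StdSimplex ℝ≥0 I)
    (p : ∀ i, StdSimplex ℝ≥0 (X i)) :
    E (Σ i, X i) (mixture α p) = (α.weights.sum fun i a => (a : ℝ) * E (X i) (p i)) + E I α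
  tendsto {X : Type} [Finite X] (p : ℕ → StdSimplex ℝ≥0 X) (q : StdSimplex ℝ≥0 X)
    (h : ∀ x, Tendsto (fun n => (p n).weights x) atTop (𝓝 (q.weights x))) :
    Tendsto (fun n => E X (p n)) atTop (𝓝 (E X q))

namespace IsFaddeevEntropy

variable {E : ∀ (X : Type) [Finite X], StdSimplex ℝ≥0 X → ℝ}

/-- The entropy of the uniform distribution on `n` points, for `n > 0`. -/
noncomputable def ofUniform (E : ∀ (X : Type) [Finite X], StdSimplex ℝ≥0 X → ℝ) (n : ℕ) : ℝ :=
  -- `n - 1 + 1` makes the type inhabited for every n; the value at 0 is that at 1.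
  E (Fin (n - 1 + 1)) (uniform _)

variable (hE : IsFaddeevEntropy E)
include hE

theorem uniform_eq (X : Type) [Fintype X] [Nonempty X] :
    E X (uniform X) = ofUniform E (Fintype.card X) := by
  have : Fintype.card X = Fintype.card X - 1 + 1 :=
    (Nat.sub_add_cancel Fintype.card_pos).symm
  rw [ofUniform, ← uniform_map (Fintype.equivFinOfCardEq this), hE.map_equiv]

/-- The chain rule for N points cut into blocks of sizes k i. Equal blocks give additivity of
`ofUniform`, blocks of sizes n and 1 control its differences, and general blocks determine E on
rational distributions. -/
theorem ofUniform_sum {I : Type} [Fintype I] (k : I → ℕ) (hk : ∀ i, k i ≠ 0)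
    (h : ∑ i, k i ≠ 0) :
    ofUniform E (∑ i, k i) =
      (∑ i, ((k i : ℝ) / ∑ i, (k i : ℝ)) * ofUniform E (k i)) + E I (ofCounts k h) := by
  have (i : I) : Nonempty (Fin (k i)) := Fin.pos_iff_nonempty.1 (Nat.pos_of_ne_zero (hk i))
  have hI : Nonempty I := by
    by_contra hI
    rw [not_nonempty_iff] at hI
    simp at h
  have hS : Nonempty (Σ i, Fin (k i)) := ⟨⟨Classical.arbitrary I, Classical.arbitrary _⟩⟩
  have hm := mixture_uniform (X := fun i => Fin (k i)) (by simpa using h)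
  simp only [Fintype.card_fin] at hm
  have := hE.uniform_eq (Σ i, Fin (k i))
  rw [← hm, hE.chain, Fintype.card_sigma] at this
  simp only [Fintype.card_fin] at this
  rw [← this, Finsupp.sum_fintype _ _ (by simp)]
  congr 1
  refine Finset.sum_congr rfl fun i _ => ?_
  rw [hE.uniform_eq, Fintype.card_fin, ofCounts_weights]
  push_cast
  rfl

theorem ofUniform_one : ofUniform E 1 = 0 := by
  have h : (uniform (Fin (1 - 1 + 1))) = StdSimplex.single 0 := by
    refine ext_weights fun x => ?_
    have : Subsingleton (Fin (1 - 1 + 1)) := inferInstanceAs (Subsingleton (Fin 1))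
    rw [uniform_weights, Subsingleton.elim x 0]
    simp
  rw [ofUniform, h, hE.single]

/-- With m blocks of size n, the distribution of the blocks is uniform on m points. -/
theorem ofUniform_mul {m n : ℕ} (hm : m ≠ 0) (hn : n ≠ 0) :
    ofUniform E (m * n) = ofUniform E m + ofUniform E n := by
  have : Nonempty (Fin m) := Fin.pos_iff_nonempty.1 (Nat.pos_of_ne_zero hm)
  have h0 : ∑ _ : Fin m, n ≠ 0 := by simp [hm, hn]
  have h := hE.ofUniform_sum (fun _ : Fin m => n) (fun _ => hn) h0
  have hu : ofCounts (fun _ : Fin m => n) h0 = uniform (Fin m) := by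
    refine ext_weights fun x => ?_
    rw [ofCounts_weights, uniform_weights]
    simp
    have : (n : ℝ≥0) ≠ 0 := by exact_mod_cast hn
    field_simp
  rw [hu, hE.uniform_eq] at h
  simp at h
  rw [h]
  have hm' : (m : ℝ) ≠ 0 := by exact_mod_cast hm
  have hn' : (n : ℝ) ≠ 0 := by exact_mod_cast hn
  field_simp
  ring

/-- Blocks of sizes n and 1 give φ(n+1) - n/(n+1) φ(n) = E(n/(n+1), 1/(n+1)), because φ(1) = 0. The
right side tends to the entropy of a point mass, which is 0. -/
theorem ofUniform_tendsto :
    Tendsto (fun n => ofUniform E (n + 1) - ofUniform E n) atTop (𝓝 0) := by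
  have h0 (n : ℕ) : ∑ b : Bool, (bif b then n else 1) ≠ 0 := by simp
  have hd : Tendsto (fun n => E Bool (ofCounts (fun b => bif b then n else 1) (h0 n))) atTop
      (𝓝 0) := by
    rw [← hE.single true]
    have hinv : Tendsto (fun n : ℕ => 1 / ((n : ℝ≥0) + 1)) atTop (𝓝 0) :=
      tendsto_one_div_add_atTop_nhds_zero_nat
    refine hE.tendsto _ _ fun b => ?_
    cases b with
    | false => simpa [ofCounts_weights] using hinv
    | true => simpa [ofCounts_weights] using tendsto_natCast_div_add_atTop (1 : ℝ≥0)
  refine tendsto_sub_of_tendsto_sub_mul (fun n => hE.nonneg _)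
    (fun n => ofUniform E (n + 1) - n / (n + 1) * ofUniform E n) (hd.congr' ?_)
    fun n => by ring
  filter_upwards [eventually_ne_atTop 0] with n hn
  have h := hE.ofUniform_sum (fun b => bif b then n else 1) (by simp [hn]) (h0 n)
  simp [hE.ofUniform_one] at h
  rw [h]
  ring

/-- With φ = c ln, solving `ofUniform_sum` for E gives c ln N - ∑ (kᵢ/N) c ln kᵢ, and the weights
kᵢ/N sum to 1. Counts must be positive because an empty block carries no distribution. -/
theorem ofCounts_eq {I : Type} [Fintype I] (k : I → ℕ) (hk : ∀ i, k i ≠ 0) (h : ∑ i, k i ≠ 0) :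
    E I (ofCounts k h) = ofUniform E 2 / Real.log 2 *
      ∑ i, Real.negMulLog ((ofCounts k h).weights i) := by
  have hlog (n : ℕ) (hn : n ≠ 0) := completelyAdditive_eq_log (fun _ _ => hE.ofUniform_mul)
    hE.ofUniform_tendsto hn
  have hs := hE.ofUniform_sum k hk h
  set c := ofUniform E 2 / Real.log 2
  have hN : (∑ i, (k i : ℝ)) ≠ 0 := by exact_mod_cast h
  have key (i : I) : c * Real.negMulLog ((ofCounts k h).weights i) =
      (k i / ∑ i, (k i : ℝ)) * (c * Real.log (∑ i, (k i : ℝ))) -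
        (k i / ∑ i, (k i : ℝ)) * ofUniform E (k i) := by
    rw [ofCounts_weights, hlog _ (hk i), Real.negMulLog]
    push_cast
    rw [Real.log_div (by exact_mod_cast hk i) hN]
    ring
  rw [hlog _ h] at hs
  rw [Finset.mul_sum, Finset.sum_congr rfl fun i _ => key i, Finset.sum_sub_distrib,
    ← Finset.sum_mul, ← Finset.sum_div, div_self hN]
  push_cast at hs
  linarith

/-- **Faddeev's theorem**: entropy is characterised by the chain rule up to a scalar. -/
theorem eq_entropy {X : Type} [Fintype X] (p : StdSimplex ℝ≥0 X) :
    E X p = ofUniform E 2 / Real.log 2 * ∑ x, Real.negMulLog (p.weights x) := by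
  have hX : Nonempty X := p.nonempty
  -- The `+ 1` keeps all counts positive, even where p vanishes; it is negligible after division by
  -- n.
  have hk (n : ℕ) (x : X) : ⌊(p.weights x : ℝ) * n⌋₊ + 1 ≠ 0 := by simp
  have hs (n : ℕ) : ∑ x, (⌊(p.weights x : ℝ) * n⌋₊ + 1) ≠ 0 := by simp [Finset.sum_add_distrib]
  let r (n : ℕ) : StdSimplex ℝ≥0 X := ofCounts (fun x => ⌊(p.weights x : ℝ) * n⌋₊ + 1) (hs n)
  have ht (x : X) : Tendsto (fun n : ℕ => ((⌊(p.weights x : ℝ) * n⌋₊ + 1 : ℕ) : ℝ≥0) / n) atTop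
      (𝓝 (p.weights x)) := by
    have h1 : Tendsto (fun n : ℕ => (⌊(p.weights x : ℝ) * n⌋₊ : ℝ) / n) atTop
        (𝓝 (p.weights x)) :=
      (tendsto_nat_floor_mul_div_atTop (p.weights x).2).comp tendsto_natCast_atTop_atTop
    have := h1.add (tendsto_inv_atTop_nhds_zero_nat (𝕜 := ℝ))
    rw [add_zero] at this
    refine NNReal.tendsto_coe.1 (this.congr fun n => ?_)
    push_cast
    rw [add_div, one_div]
  have htot : ∑ x, p.weights x = 1 := by
    rw [← p.total, Finsupp.sum_fintype _ _ fun _ => rfl]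
  have hr (x : X) : Tendsto (fun n => (r n).weights x) atTop (𝓝 (p.weights x)) := by
    -- The weight of `r n` at x is the quotient of count / n by the sum of all counts / n, and this
    -- sum tends to 1.
    have := (ht x).div (tendsto_finsetSum Finset.univ fun y _ => ht y) (by simp [htot])
    rw [htot, div_one] at this
    refine this.congr' ?_
    filter_upwards [eventually_gt_atTop 0] with n hn
    have hn' : (n : ℝ≥0) ≠ 0 := by exact_mod_cast hn.ne'
    rw [Pi.div_apply, ← Finset.sum_div, div_div_div_cancel_right₀ hn']
    rfl
  refine tendsto_nhds_unique (hE.tendsto r p hr) ?_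
  have (n : ℕ) := hE.ofCounts_eq _ (hk n) (hs n)
  simp only [r, this]
  refine (tendsto_finsetSum _ fun x _ => ?_).const_mul _
  exact (Real.continuous_negMulLog.tendsto _).comp
    ((NNReal.continuous_coe.tendsto _).comp (hr x))

end IsFaddeevEntropy

end Faddeev

/-! ### The entropy attached to a monoidal functor -/

namespace BNNReal

theorem val_eq_zero_of_isIso {x y : BNNReal} (f : x ⟶ y) [IsIso f] : val f = 0 := by
  have h := val_comp f (inv f)
  rw [IsIso.hom_inv_id, val_id] at h
  exact (add_eq_zero.1 h.symm).1

end BNNReal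

namespace FinProb

/-- The measure preserving function given by `f : X → Y`. -/
def homMk {X Y : FintypeCat.{u}} {p : StdSimplex ℝ≥0 X} {q : StdSimplex ℝ≥0 Y} (f : X → Y)
    (h : p.map f = q) : of X p ⟶ of Y q :=
  ⟨FintypeCat.homMk f, h⟩

/-- The one-point probability space. -/
noncomputable def point : FinProb.{u} := of (FintypeCat.of PUnit) (StdSimplex.single PUnit.unit)

/-- The unique morphism to the one-point probability space. -/
noncomputable def toPoint (P : FinProb.{u}) : P ⟶ point :=
  homMk (X := P.carrier) (p := P.prob) (fun _ => PUnit.unit) (StdSimplex.map_const _ _)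

theorem toPoint_unique {P : FinProb.{u}} (f g : P ⟶ point) : f = g :=
  Subtype.ext (FintypeCat.hom_ext _ _ fun _ => rfl)

variable (F : OMonoidalFunctor QConv FinProb.{u} BNNReal)

/-- The value of `F` on the morphism to the one-point space. -/
noncomputable def entropyOf (P : FinProb.{u}) : ℝ≥0 := BNNReal.val (F.map (toPoint P))

/-- Functoriality along P → Q → pt. The additive form avoids truncated subtraction in ℝ≥0. -/
theorem val_map_add_entropyOf {P Q : FinProb.{u}} (f : P ⟶ Q) :
    BNNReal.val (F.map f) + entropyOf F Q = entropyOf F P := by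
  rw [entropyOf, entropyOf, ← BNNReal.val_comp, ← F.map_comp]
  exact congrArg (fun g => BNNReal.val (F.map g)) (toPoint_unique _ _)

theorem entropyOf_le {P Q : FinProb.{u}} (f : P ⟶ Q) : entropyOf F Q ≤ entropyOf F P := by
  rw [← val_map_add_entropyOf F f]
  exact le_add_self

theorem entropyOf_point : entropyOf F point = 0 := by
  rw [entropyOf, toPoint_unique (toPoint point) (𝟙 point), F.map_id, BNNReal.val_id]

/-- Entropy decreases along morphisms, and both e and its inverse are measure preserving. -/
theorem entropyOf_map {X Y : FintypeCat.{u}} (e : X ≃ Y) (p : StdSimplex ℝ≥0 X) :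
    entropyOf F (of Y (p.map e)) = entropyOf F (of X p) := by
  refine le_antisymm (entropyOf_le F (homMk e rfl)) (entropyOf_le F (homMk e.symm ?_))
  rw [StdSimplex.map_map]
  simp only [Equiv.symm_apply_apply]
  exact StdSimplex.map_id p

theorem entropyOf_single {X : FintypeCat.{u}} (x : X) :
    entropyOf F (of X (StdSimplex.single x)) = 0 := by
  refine le_antisymm ((entropyOf_le F (P := point) (homMk (fun _ => x) ?_)).trans_eq
    (entropyOf_point F)) zero_le
  exact StdSimplex.map_single _ _

/-- Strong monoidality enters here: the naturality square of `lax` is an equation in ℝ≥0 in which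
both `lax` terms are invertible, hence 0. -/
theorem weightedSum_val_map {I : Type} [Finite I] (α : QConv.Op I) {P Q : I → FinProb.{u}}
    (f : ∀ i, P i ⟶ Q i) :
    BNNReal.val (F.map (OMonoidal.tensorMap α f)) =
      BNNReal.weightedSum α fun i => BNNReal.val (F.map (f i)) := by
  have h := congrArg BNNReal.val (F.lax_naturality α f)
  have := F.isIso_lax α P
  have := F.isIso_lax α Q
  rw [BNNReal.val_comp, BNNReal.val_comp, BNNReal.val_eq_zero_of_isIso (F.lax α Q),
    BNNReal.val_eq_zero_of_isIso (F.lax α P), add_zero, zero_add] at h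
  exact h.symm

/-- This is the chain rule: ⊗_α of the maps to the point collapses each Xᵢ, leaving I × pt with
distribution α. `ULift` appears because operadic labels live in `Type` and the sets of `FinProb` in
universe u. -/
theorem entropyOf_mixture {I : Type} [Finite I] (α : StdSimplex ℝ≥0 I) {X : I → FintypeCat.{u}}
    (p : ∀ i, StdSimplex ℝ≥0 (X i)) :
    entropyOf F (of (FintypeCat.of (Σ i, X i)) (mixture α p)) =
      (BNNReal.weightedSum α fun i => entropyOf F (of (X i) (p i))) +
        entropyOf F (of (FintypeCat.of (ULift.{u} I)) (α.map ULift.up)) := by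
  have h := val_map_add_entropyOf F
    (OMonoidal.tensorMap (O := QConv) α fun i => toPoint (of (X i) (p i)))
  replace h := (congrArg (· + _) (weightedSum_val_map F α fun i => toPoint _)).symm.trans h
  refine h.symm.trans (congrArg _ ?_)
  let e : (Σ _ : I, PUnit.{u + 1}) ≃ ULift.{u} I :=
    (Equiv.sigmaPUnit I).trans Equiv.ulift.symm
  refine (entropyOf_map F (X := FintypeCat.of (Σ _ : I, PUnit.{u + 1}))
    (Y := FintypeCat.of (ULift.{u} I)) e
      (mixture α fun _ => StdSimplex.single PUnit.unit)).symm.trans ?_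
  congr 2
  refine StdSimplex.ext_weights fun ⟨i⟩ => ?_
  rw [StdSimplex.map_equiv_weights]
  refine (StdSimplex.mixture_weights _ _ _ _).trans ?_
  have := StdSimplex.map_equiv_weights Equiv.ulift.{u}.symm α ⟨i⟩
  refine Eq.trans ?_ this.symm
  simp [Equiv.ulift]

/-- Sending p to the morphism (X, p) → pt is a continuous map into the fibre over X → pt: its source
coordinate is the identity and its target coordinate is constant. -/
theorem continuous_entropyOf
    (hF : IsFibrewiseContinuous finProbTopology BNNReal.topology F.toFunctor) (X : FintypeCat.{u}) :
    @Continuous (StdSimplex ℝ≥0 X) ℝ≥0 (distTopology X) _ fun p => entropyOf F (of X p) := by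
  obtain ⟨T, sq, -, h⟩ := hF
  let f : X ⟶ FintypeCat.of PUnit.{u + 1} := FintypeCat.homMk fun _ => PUnit.unit
  let s (p : StdSimplex ℝ≥0 X) : HomFiber distFunctor.proj f :=
    ⟨of X p, point, toPoint (of X p),
      Functor.IsHomLift.map (p := distFunctor.proj) (toPoint (of X p))⟩
  have hs : @Continuous _ _ (distTopology X) (finProbTopology.homTop f) s := by
    let _ := distTopology X
    let _ := finProbTopology.objTop X
    let _ := finProbTopology.objTop (FintypeCat.of PUnit.{u + 1})
    refine continuous_induced_rng.2 (Continuous.prodMk ?_ ?_)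
    · refine continuous_induced_rng.2 ?_
      exact continuous_id.congr fun p => (StdSimplex.map_id p).symm
    · exact @continuous_const _ (distFunctor.proj.Fiber (FintypeCat.of PUnit.{u + 1})) _ _
        ⟨point, rfl⟩
  let _ := distTopology X
  let _ := finProbTopology.homTop f
  let _ := BNNReal.topology.homTop (T.map f)
  exact (continuous_induced_dom.comp (h f)).comp hs

/-- The entropy of distributions on sets in the lowest universe. -/
noncomputable def smallEntropyOf (X : Type) [Finite X] (p : StdSimplex ℝ≥0 X) : ℝ :=
  entropyOf F (of (FintypeCat.of (ULift.{u} X)) (p.map ULift.up))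

theorem isFaddeevEntropy_smallEntropyOf
    (hF : IsFibrewiseContinuous finProbTopology BNNReal.topology F.toFunctor) :
    IsFaddeevEntropy (smallEntropyOf F) where
  nonneg _ := NNReal.coe_nonneg _
  map_equiv {X Y _ _} e p := by
    rw [smallEntropyOf, smallEntropyOf,
      ← entropyOf_map F (X := FintypeCat.of (ULift.{u} X)) (Y := FintypeCat.of (ULift.{u} Y))
      (Equiv.ulift.trans (e.trans Equiv.ulift.symm))]
    rw [StdSimplex.map_map, StdSimplex.map_map]
    rfl
  single x := by
    rw [smallEntropyOf, StdSimplex.map_single, entropyOf_single, NNReal.coe_zero]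
  chain {I _ X _} α p := by
    have h := entropyOf_mixture F α (X := fun i => FintypeCat.of (ULift.{u} (X i)))
      fun i => (p i).map ULift.up
    rw [mixture_map α p fun i => ULift.up] at h
    rw [smallEntropyOf, ← entropyOf_map F (X := FintypeCat.of (ULift.{u} (Σ i, X i)))
      (Y := FintypeCat.of (Σ i, ULift.{u} (X i)))
      (Equiv.ulift.trans (Equiv.sigmaCongrRight fun _ => Equiv.ulift.symm)), StdSimplex.map_map]
    refine (congrArg _ h).trans ?_
    rw [NNReal.coe_add, BNNReal.weightedSum]
    simp only [Finsupp.sum, NNReal.coe_sum, NNReal.coe_mul]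
    rfl
  tendsto {X _} p q h := by
    let _ : TopologicalSpace (StdSimplex ℝ≥0 (ULift.{u} X)) :=
      distTopology (FintypeCat.of (ULift.{u} X))
    have hc := (continuous_entropyOf F hF (FintypeCat.of (ULift.{u} X))).tendsto (q.map ULift.up)
    refine NNReal.tendsto_coe.2 (hc.comp (f := fun n => (p n).map ULift.up) ?_)
    -- The topology is induced from a product, so convergence of each weight suffices.
    refine (Filter.tendsto_comap_iff.2 (tendsto_pi_nhds.2 fun x => ?_)).mono_right
      (nhds_induced _ _).ge
    have hw (r : StdSimplex ℝ≥0 X) : (r.map ULift.up).weights x = r.weights x.down :=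
      StdSimplex.map_equiv_weights Equiv.ulift.symm r x
    simp only [Function.comp_def, hw]
    exact h x.down

theorem shannonEntropy_eq (P : FinProb.{u}) [Fintype P.carrier] :
    shannonEntropy P = ∑ x, Real.negMulLog (P.prob.weights x) := by
  rw [shannonEntropy, Finsupp.sum_fintype _ _ (by simp), ← Finset.sum_neg_distrib]
  simp [Real.negMulLog]

/-- A bijection with some `Fin n` moves P to the lowest universe, where Faddeev's theorem applies.
-/
theorem entropyOf_eq (hF : IsFibrewiseContinuous finProbTopology BNNReal.topology F.toFunctor)
    (P : FinProb.{u}) :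
    (entropyOf F P : ℝ) =
      IsFaddeevEntropy.ofUniform (smallEntropyOf F) 2 / Real.log 2 * shannonEntropy P := by
  let _ : Fintype P.carrier := Fintype.ofFinite _
  let e := Fintype.equivFin P.carrier
  have h := (isFaddeevEntropy_smallEntropyOf F hF).eq_entropy (P.prob.map e)
  rw [smallEntropyOf, StdSimplex.map_map] at h
  rw [shannonEntropy_eq]
  refine Eq.trans ?_ (h.trans (congrArg _ ?_))
  · exact congrArg _ (entropyOf_map F (Y := FintypeCat.of (ULift.{u} (Fin _)))
      (e.trans Equiv.ulift.symm) P.prob).symm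
  · rw [← e.sum_comp]
    simp only [StdSimplex.map_equiv_weights, Equiv.symm_apply_apply]

end FinProb

theorem mainTheorem7
    (F : OMonoidalFunctor QConv FinProb.{u} BNNReal)
    (hF : IsFibrewiseContinuous finProbTopology BNNReal.topology F.toFunctor) :
    ∃ c : ℝ≥0, ∀ {P Q : FinProb.{u}} (f : P ⟶ Q),
      (BNNReal.val (F.map f) : ℝ) = c * (shannonEntropy P - shannonEntropy Q) := by
  -- The constant is the value of E on a fair coin divided by its Shannon entropy ln 2.
  have hc : 0 ≤ IsFaddeevEntropy.ofUniform (FinProb.smallEntropyOf F) 2 / Real.log 2 :=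
    div_nonneg ((FinProb.isFaddeevEntropy_smallEntropyOf F hF).nonneg _)
      (Real.log_nonneg one_le_two)
  refine ⟨⟨_, hc⟩, fun {P Q} f => ?_⟩
  change _ = IsFaddeevEntropy.ofUniform (FinProb.smallEntropyOf F) 2 / Real.log 2 * _
  rw [mul_sub, ← FinProb.entropyOf_eq F hF, ← FinProb.entropyOf_eq F hF,
    ← FinProb.val_map_add_entropyOf F f, NNReal.coe_add, add_sub_cancel_right]
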